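/- Theorem. Let $n\ge 2$ be an integer and let $R$ be a commutative associative ring with unity. A "sum of $k$-th powers in $M_n(R)$" means a finite sum of $k$-th powers of $n\times n$ matrices over $R$. (A) The following are equivalent: (1) every matrix in $M_n(R)$ is a sum of squares of matrices in $M_n(R)$; (2) every matrix in $M_n(R)$ is a sum of $4$-th powers of matrices in $M_n(R)$; (3) every matrix in $M_n(R)$ is a sum of $8$-th powers of matrices in $M_n(R)$; (4) every matrix in $M_n(R)$ is a sum of $16$-th powers of matrices in $M_n(R)$; (5) every element of $R$ is a square modulo $2R$, i.e. for every $x\in R$ there is $a\in R$ with $x-a^2\in 2R$. (B) If moreover $R$ is an order in an algebraic number field $K$ (a subring of $K$ that is a finitely generated $\mathbb Z$-module of rank $[K:\mathbb Q]$), then (1)–(5) are also equivalent to $\gcd(2,\operatorname{disc}R)=1$, where $\operatorname{disc}R$ is the determinant of the trace form on a $\mathbb Z$-basis of $R$. (C) Let $$\bar W(2,4,R)=\{a_0^{16}+2a_1^8+4a^4+16a+16a^{2m+1}\mid a_0,a_1,a\in R,\ m\in\mathbb Z,\ m\ge 1\},$$ $$W(2,5,R)=\{b_0^{32}+2b_1^{16}+4b_2^{8}+8b_3^{4}+16b_4^{2}+32b_5\mid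 b_0,\dots,b_5\in R\},$$ and $W^*(2,4,R)=\bar W(2,4,R)\cup W(2,5,R)$. If $M\in M_n(R)$ and $\operatorname{tr}(M)\in W^*(2,4,R)$, then $M$ is a sum of $16$-th powers in $M_n(R)$. -/

import Mathlib

universe u v

namespace MatrixWaring

/-- `M` is a (finite) sum of `k`-th powers of `n × n` matrices over `R`. -/
def IsSumOfPowers {R : Type*} [CommRing R] {n : ℕ} (k : ℕ) (M : Matrix (Fin n) (Fin n) R) : Prop :=
  ∃ (r : ℕ) (A : Fin r → Matrix (Fin n) (Fin n) R), M = ∑ i, A i ^ k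

/-- Every `n × n` matrix over `R` is a sum of `k`-th powers of `n × n` matrices over `R`. -/
def EveryMatrixIsSumOfPowers (n k : ℕ) (R : Type*) [CommRing R] : Prop :=
  ∀ M : Matrix (Fin n) (Fin n) R, IsSumOfPowers k M

/-- Every element of `R` is a square modulo the ideal `2R`. -/
def EveryElementIsSquareModTwo (R : Type*) [CommRing R] : Prop :=
  ∀ x : R, ∃ a : R, x - a ^ 2 ∈ Ideal.span {(2 : R)}

/-- `W(p, s, R) = {a₀^(p^s) + p a₁^(p^(s-1)) + ⋯ + p^s a_s | a₀, …, a_s ∈ R}`. -/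
def W (p s : ℕ) (R : Type*) [CommRing R] : Set R :=
  {x | ∃ a : Fin (s + 1) → R, x = ∑ i : Fin (s + 1), (p : R) ^ (i : ℕ) * a i ^ p ^ (s - (i : ℕ))}

/-- The set of all `a₀^16 + 2 a₁^8 + 4 a^4 + 16 a + 16 a^(2m+1)` with `m` a positive integer. -/
def Wbar (R : Type*) [CommRing R] : Set R :=
  {x | ∃ (a₀ a₁ a : R) (m : ℕ), 1 ≤ m ∧
    x = a₀ ^ 16 + 2 * a₁ ^ 8 + 4 * a ^ 4 + 16 * a + 16 * a ^ (2 * m + 1)}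

/-- `W*(2, 4, R)`. -/
def Wstar (R : Type*) [CommRing R] : Set R := Wbar R ∪ W 2 5 R

/-- A subring `O` of a number field `K` is an order if it is a finitely generated `ℤ`-module
of maximal rank `[K : ℚ]`. -/
structure IsOrder {K : Type*} [Field K] [NumberField K] (O : Subring K) : Prop where
  finite : Module.Finite ℤ O
  finrank_eq : Module.finrank ℤ O = Module.finrank ℚ K

/-- The discriminant of an order: the determinant of the trace form on a `ℤ`-basis. -/
noncomputable def IsOrder.disc {K : Type*} [Field K] [NumberField K] {O : Subring K}
    (hO : IsOrder O) : ℤ :=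
  have := hO.finite
  Algebra.discr ℤ (Module.Free.chooseBasis ℤ O)

/-- The discriminant does not depend on the basis. -/
theorem IsOrder.disc_eq {K : Type*} [Field K] [NumberField K] {O : Subring K}
    (hO : IsOrder O) {ι : Type*} [Fintype ι] [DecidableEq ι] (b : Module.Basis ι ℤ O) :
    hO.disc = Algebra.discr ℤ b := by
  have := hO.finite
  let c := Module.Free.chooseBasis ℤ O
  have h : Algebra.discr ℤ (c.reindex (c.indexEquiv b)) = Algebra.discr ℤ c := by
    rw [Module.Basis.coe_reindex, Algebra.discr_reindex]
  exact h.symm.trans (Algebra.discr_eq_discr _ _ _)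

end MatrixWaring

/-!
Let `T` be the set of traces of sums of `16`-th powers of `n × n` matrices over `R`. Idempotents
are `16`-th powers, and so are the order-three matrix `w` with block `!![0, -1; 1, -1]` and its
square, for which `w + w ^ 2` is `-1` on the block. This already produces every matrix of trace `0`
(`mem_sumsOfPowers_of_trace_eq_zero`), so that a matrix is a sum of `16`-th powers if and only if
its trace lies in `T` (`mem_sumsOfPowers_iff`), and the problem becomes one about the additive
monoid `T`.

From `tr (A ^ 2) = (tr A) ^ 2 - 2 * det A`, the `16`-th power of a `2 × 2` matrix of trace `t` and
determinant `d` has trace a fixed polynomial `tracePow t d`, and padding with zeros shows that `T`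
contains all its values. The rest is done with these values. Higher differences give `16! R ⊆ T`,
which makes `T` a group; an explicit combination gives `96 x ∈ T`, and then `32 x ∈ T`. Working
modulo `32 R`, repeated polarization yields `16 x ^ 2`, `8 x ^ 4`, `4 x ^ 4 + 16 x + 16 x ^ 3` and
`16 x ^ (2 m + 1) + 16 x ^ 3`, whence `W*(2, 4, R) ⊆ T` (`Wstar_subset`).

If all elements of `R` are squares modulo `2`, they are also `2 ^ k`-th powers modulo `2`, and
peeling off such powers puts every element of `R` into `W(2, 5, R)`. Conversely
`tr (A ^ 2) ≡ (tr A) ^ 2` modulo `2`, so if every matrix is a sum of squares then every element of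
`R` is a square modulo `2`.

For an order `O` the condition says that the Frobenius map of the finite ring `O / 2 O` is
surjective, equivalently injective, equivalently that `O / 2 O` is reduced. Over the perfect field
with two elements this means that the trace form of `O / 2 O` is nondegenerate, i.e. that the
discriminant of `O` is nonzero modulo `2`.
-/

namespace MatrixWaring

/-! ### Additive groups containing the traces of sixteenth powers -/

/-- The trace of the `16`-th power of a `2 × 2` matrix with trace `t` and determinant `d`. -/
def tracePow {R : Type*} [CommRing R] (t d : R) : R :=
  (((t ^ 2 - 2 * d) ^ 2 - 2 * d ^ 2) ^ 2 - 2 * d ^ 4) ^ 2 - 2 * d ^ 8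

section TracePow

variable {R : Type*} [CommRing R]

/-- `T` contains `y ^ 16` and `-y ^ 16`, hence the `15`-th difference of `y ^ 16`, which is
`16! * x` plus a constant. -/
lemma factorial_mul_mem {T : AddSubmonoid R} (hT : ∀ t d : R, tracePow t d ∈ T) (x : R) :
    (Nat.factorial 16 : R) * x ∈ T := by
  have pos (y : R) : y ^ 16 ∈ T := by
    convert hT y 0 using 1
    simp only [tracePow]; ring
  -- Trace `-y` and determinant `y ^ 2`: the eigenvalues are `y` times the primitive cube roots
  -- of unity, whose `16`-th powers add up to `-1`.
  have neg (y : R) : -y ^ 16 ∈ T := by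
    convert hT (-y) (y ^ 2) using 1
    simp only [tracePow]; ring
  have key : (Nat.factorial 16 : R) * x =
      ∑ i ∈ Finset.range 16, Nat.choose 15 i • ((-1) ^ (i + 1) * (x + i) ^ 16) +
        (15 * Nat.factorial 15 * 8) • (-1 : R) := by
    simp only [Finset.sum_range_succ, Finset.sum_range_zero, Nat.factorial, Nat.choose]
    push_cast
    ring
  rw [key]
  refine add_mem (sum_mem fun i _ ↦ nsmul_mem ?_ _) ?_
  · rcases neg_one_pow_eq_or R (i + 1) with h | h <;> rw [h]
    · simpa using pos (x + i)
    · simpa using neg (x + i)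
  · refine nsmul_mem ?_ _
    simpa using neg 1

/-- Since `16! R ⊆ T`, negation in `T` may be replaced by multiplication by `16! - 1`; so `T` is
a subgroup. -/
lemma neg_mem_of_tracePow_mem {T : AddSubmonoid R} (hT : ∀ t d : R, tracePow t d ∈ T) {x : R}
    (hx : x ∈ T) : -x ∈ T := by
  have h : -x = (Nat.factorial 16 : R) * (-x) + (Nat.factorial 16 - 1) • x := by
    simp only [Nat.factorial, nsmul_eq_mul]
    norm_num
    ring
  rw [h]
  exact add_mem (factorial_mul_mem hT _) (nsmul_mem hx _)

variable {T : AddSubgroup R}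

lemma two_mul_pow_eight_mem (hT : ∀ t d : R, tracePow t d ∈ T) (x : R) : 2 * x ^ 8 ∈ T := by
  convert hT 0 x using 1
  simp only [tracePow]; ring

lemma ninety_six_mul_mem (hT : ∀ t d : R, tracePow t d ∈ T) (x : R) : 96 * x ∈ T := by
  have h (a : R) : tracePow 1 (a + x) - tracePow 1 (a - x) ∈ T := sub_mem (hT _ _) (hT _ _)
  -- Each difference is odd in `x`, of degree `7`; the coefficients come from a lattice reduction
  -- and cancel all terms of degree above `1`.
  have key : 96 * x =
      (6 : ℤ) • (tracePow 1 (-3 + x) - tracePow 1 (-3 - x)) +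
      (-52 : ℤ) • (tracePow 1 (-2 + x) - tracePow 1 (-2 - x)) +
      (-1 : ℤ) • (tracePow 1 (-1 + x) - tracePow 1 (-1 - x)) +
      (18 : ℤ) • (tracePow 1 (0 + x) - tracePow 1 (0 - x)) +
      (85 : ℤ) • (tracePow 1 (1 + x) - tracePow 1 (1 - x)) +
      (-101 : ℤ) • (tracePow 1 (2 + x) - tracePow 1 (2 - x)) +
      (150 : ℤ) • (tracePow 1 (3 + x) - tracePow 1 (3 - x)) := by
    simp only [tracePow, zsmul_eq_mul]
    push_cast
    ring
  rw [key]
  repeat' first | apply add_mem | apply zsmul_mem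
  all_goals exact h _

/-- Up to a constant and a multiple of `2 * y ^ 8`, the sum of `tracePow 1 y` and `tracePow 1 (-y)`
is congruent to `4 * y ^ 2` modulo `12`. Eight times it gives `32 * y ^ 2`, and then `64 * x`. -/
lemma thirty_two_mul_mem (hT : ∀ t d : R, tracePow t d ∈ T) (x : R) : 32 * x ∈ T := by
  have hsq (y : R) : 32 * y ^ 2 ∈ T := by
    have key : 32 * y ^ 2 = (8 : ℤ) • (tracePow 1 y + tracePow 1 (-y)) +
        (-16 : ℤ) • (tracePow 1 0) + (-16 : ℤ) • (2 * y ^ 8) +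
        -(96 * (56 * y ^ 6 + 110 * y ^ 4 + 17 * y ^ 2)) := by
      simp only [tracePow, zsmul_eq_mul]
      push_cast
      ring
    rw [key]
    exact add_mem (add_mem (add_mem (zsmul_mem (add_mem (hT _ _) (hT _ _)) _)
      (zsmul_mem (hT _ _) _)) (zsmul_mem (two_mul_pow_eight_mem hT _) _))
      (neg_mem (ninety_six_mul_mem hT _))
  have key : 32 * x = 96 * x - (32 * (x + 1) ^ 2 - 32 * x ^ 2 - 32 * 1 ^ 2) := by ring
  rw [key]
  exact sub_mem (ninety_six_mul_mem hT x) (sub_mem (sub_mem (hsq _) (hsq _)) (hsq _))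

/-- The residue of `tracePow 1 x` modulo `32 R`, without its terms that are known to lie in `T`. -/
lemma tracePow_one_mod_mem (hT : ∀ t d : R, tracePow t d ∈ T) (x : R) :
    16 * x ^ 6 + 20 * x ^ 4 + 8 * x ^ 2 + 16 * x ∈ T := by
  have key : 16 * x ^ 6 + 20 * x ^ 4 + 8 * x ^ 2 + 16 * x =
      tracePow 1 x - tracePow 1 0 - 2 * x ^ 8 +
        32 * (2 * x ^ 7 - 10 * x ^ 6 + 21 * x ^ 5 - 20 * x ^ 4 + 11 * x ^ 3 - 3 * x ^ 2 + x) := by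
    simp only [tracePow]; ring
  rw [key]
  exact add_mem (sub_mem (sub_mem (hT _ _) (hT _ _)) (two_mul_pow_eight_mem hT x))
    (thirty_two_mul_mem hT _)

/-- Polarizing `tracePow_one_mod_mem` at `(x, 1)` gives `8 x² + 16 x³ + 16 x⁴`, and polarizing
that once more gives `16 x²`, all modulo `32 R`. -/
lemma sixteen_mul_sq_mem (hT : ∀ t d : R, tracePow t d ∈ T) (x : R) : 16 * x ^ 2 ∈ T := by
  have h1 (y : R) : 8 * y ^ 2 + 16 * y ^ 3 + 16 * y ^ 4 ∈ T := by
    have key : 8 * y ^ 2 + 16 * y ^ 3 + 16 * y ^ 4 =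
        (16 * (y + 1) ^ 6 + 20 * (y + 1) ^ 4 + 8 * (y + 1) ^ 2 + 16 * (y + 1)) -
        (16 * y ^ 6 + 20 * y ^ 4 + 8 * y ^ 2 + 16 * y) -
        (16 * 1 ^ 6 + 20 * 1 ^ 4 + 8 * 1 ^ 2 + 16 * 1) -
        32 * (3 * y ^ 5 + 7 * y ^ 4 + 12 * y ^ 3 + 11 * y ^ 2 + 6 * y) := by ring
    rw [key]
    exact sub_mem (sub_mem (sub_mem (tracePow_one_mod_mem hT _) (tracePow_one_mod_mem hT _))
      (tracePow_one_mod_mem hT _)) (thirty_two_mul_mem hT _)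
  have key : 16 * x ^ 2 = (8 * (x + 1) ^ 2 + 16 * (x + 1) ^ 3 + 16 * (x + 1) ^ 4) -
      (8 * x ^ 2 + 16 * x ^ 3 + 16 * x ^ 4) - (8 * 1 ^ 2 + 16 * 1 ^ 3 + 16 * 1 ^ 4) -
      32 * (2 * x ^ 3 + 4 * x ^ 2 + 4 * x) := by ring
  rw [key]
  exact sub_mem (sub_mem (sub_mem (h1 _) (h1 _)) (h1 _)) (thirty_two_mul_mem hT _)

/-- Modulo `32 R` and the elements `16 * z ^ 2`, this is the polarization of `tracePow 1` at
`(x, 1)`. -/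
lemma eight_mul_sq_add_mem (hT : ∀ t d : R, tracePow t d ∈ T) (x : R) :
    8 * x ^ 2 + 16 * x ^ 3 ∈ T := by
  have h (y : R) : 4 * y ^ 4 + 8 * y ^ 2 + 16 * y ∈ T := by
    have key : 4 * y ^ 4 + 8 * y ^ 2 + 16 * y =
        (16 * y ^ 6 + 20 * y ^ 4 + 8 * y ^ 2 + 16 * y) -
          (16 * (y ^ 3) ^ 2 + 16 * (y ^ 2) ^ 2) := by ring
    rw [key]
    exact sub_mem (tracePow_one_mod_mem hT y)
      (add_mem (sixteen_mul_sq_mem hT _) (sixteen_mul_sq_mem hT _))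
  have key : 8 * x ^ 2 + 16 * x ^ 3 =
      (4 * (x + 1) ^ 4 + 8 * (x + 1) ^ 2 + 16 * (x + 1)) - (4 * x ^ 4 + 8 * x ^ 2 + 16 * x) -
        (4 * 1 ^ 4 + 8 * 1 ^ 2 + 16 * 1) - 16 * x ^ 2 - 32 * x := by ring
  rw [key]
  exact sub_mem (sub_mem (sub_mem (sub_mem (h _) (h _)) (h _)) (sixteen_mul_sq_mem hT _))
    (thirty_two_mul_mem hT _)

lemma eight_mul_pow_four_mem (hT : ∀ t d : R, tracePow t d ∈ T) (x : R) : 8 * x ^ 4 ∈ T := by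
  have key : 8 * x ^ 4 = (8 * (x ^ 2) ^ 2 + 16 * (x ^ 2) ^ 3) - 16 * (x ^ 3) ^ 2 := by ring
  rw [key]
  exact sub_mem (eight_mul_sq_add_mem hT _) (sixteen_mul_sq_mem hT _)

lemma four_mul_pow_four_add_mem (hT : ∀ t d : R, tracePow t d ∈ T) (x : R) :
    4 * x ^ 4 + 16 * x + 16 * x ^ 3 ∈ T := by
  have key : 4 * x ^ 4 + 16 * x + 16 * x ^ 3 =
      (16 * x ^ 6 + 20 * x ^ 4 + 8 * x ^ 2 + 16 * x) -
        (16 * (x ^ 3) ^ 2 + 16 * (x ^ 2) ^ 2) - (8 * x ^ 2 + 16 * x ^ 3) + 32 * x ^ 3 := by ring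
  rw [key]
  exact add_mem (sub_mem (sub_mem (tracePow_one_mod_mem hT x)
      (add_mem (sixteen_mul_sq_mem hT _) (sixteen_mul_sq_mem hT _)))
      (eight_mul_sq_add_mem hT x)) (thirty_two_mul_mem hT _)

/-- The polarization of `8 * z ^ 2 + 16 * z ^ 3`, modulo `32 R`. -/
lemma sixteen_mul_polar_mem (hT : ∀ t d : R, tracePow t d ∈ T) (x y : R) :
    16 * (x * y + x ^ 2 * y + x * y ^ 2) ∈ T := by
  have key : 16 * (x * y + x ^ 2 * y + x * y ^ 2) =
      (8 * (x + y) ^ 2 + 16 * (x + y) ^ 3) - (8 * x ^ 2 + 16 * x ^ 3) -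
        (8 * y ^ 2 + 16 * y ^ 3) - 32 * (x ^ 2 * y + x * y ^ 2) := by ring
  rw [key]
  exact sub_mem (sub_mem (sub_mem (eight_mul_sq_add_mem hT _) (eight_mul_sq_add_mem hT _))
    (eight_mul_sq_add_mem hT _)) (thirty_two_mul_mem hT _)

lemma sixteen_mul_odd_pow_add_mem (hT : ∀ t d : R, tracePow t d ∈ T) (x : R) (m : ℕ)
    (hm : 1 ≤ m) : 16 * x ^ (2 * m + 1) + 16 * x ^ 3 ∈ T := by
  induction m using Nat.strong_induction_on with
  | _ m ih =>
    obtain rfl | hm' := hm.eq_or_lt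
    · convert thirty_two_mul_mem hT (x ^ 3) using 1; ring
    -- The polarization at `x`, `x ^ m` reads `x ^ (m + 1) + x ^ (m + 2) + x ^ (2 * m + 1)`;
    -- one of `m + 1`, `m + 2` is even, and the other is an odd exponent below `2 * m + 1`.
    have hp := sixteen_mul_polar_mem hT x (x ^ m)
    obtain ⟨k, rfl | rfl⟩ := m.even_or_odd'
    · have key : 16 * x ^ (2 * (2 * k) + 1) + 16 * x ^ 3 =
          16 * (x * x ^ (2 * k) + x ^ 2 * x ^ (2 * k) + x * (x ^ (2 * k)) ^ 2) -
            16 * (x ^ (k + 1)) ^ 2 + (16 * x ^ (2 * k + 1) + 16 * x ^ 3) -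
            32 * x ^ (2 * k + 1) := by ring
      rw [key]
      exact sub_mem (add_mem (sub_mem hp (sixteen_mul_sq_mem hT _))
        (ih k (by omega) (by omega))) (thirty_two_mul_mem hT _)
    · have key : 16 * x ^ (2 * (2 * k + 1) + 1) + 16 * x ^ 3 =
          16 * (x * x ^ (2 * k + 1) + x ^ 2 * x ^ (2 * k + 1) + x * (x ^ (2 * k + 1)) ^ 2) -
            16 * (x ^ (k + 1)) ^ 2 + (16 * x ^ (2 * (k + 1) + 1) + 16 * x ^ 3) -
            32 * x ^ (2 * (k + 1) + 1) := by ring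
      rw [key]
      exact sub_mem (add_mem (sub_mem hp (sixteen_mul_sq_mem hT _))
        (ih (k + 1) (by omega) (by omega))) (thirty_two_mul_mem hT _)

lemma pow_sixteen_mem (hT : ∀ t d : R, tracePow t d ∈ T) (x : R) : x ^ 16 ∈ T := by
  convert hT x 0 using 1
  simp only [tracePow]; ring

lemma Wbar_subset (hT : ∀ t d : R, tracePow t d ∈ T) : Wbar R ⊆ T := by
  rintro _ ⟨a₀, a₁, a, m, hm, rfl⟩
  have key : a₀ ^ 16 + 2 * a₁ ^ 8 + 4 * a ^ 4 + 16 * a + 16 * a ^ (2 * m + 1) =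
      a₀ ^ 16 + 2 * a₁ ^ 8 + (4 * a ^ 4 + 16 * a + 16 * a ^ 3) +
        (16 * a ^ (2 * m + 1) + 16 * a ^ 3) - 32 * a ^ 3 := by ring
  rw [key]
  exact sub_mem (add_mem (add_mem (add_mem (pow_sixteen_mem hT _) (two_mul_pow_eight_mem hT _))
    (four_mul_pow_four_add_mem hT _)) (sixteen_mul_odd_pow_add_mem hT a m hm))
    (thirty_two_mul_mem hT _)

lemma W_two_five_subset (hT : ∀ t d : R, tracePow t d ∈ T) : W 2 5 R ⊆ T := by
  rintro _ ⟨b, rfl⟩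
  have key : ∑ i : Fin (5 + 1), ((2 : ℕ) : R) ^ (i : ℕ) * b i ^ 2 ^ (5 - (i : ℕ)) =
      (b 0 ^ 2) ^ 16 + 2 * (b 1 ^ 2) ^ 8 + (2 * b 2 ^ 8 + 2 * b 2 ^ 8) + 8 * b 3 ^ 4 +
        16 * b 4 ^ 2 + 32 * b 5 := by
    rw [Fin.sum_univ_six]
    change ((2 : ℕ) : R) ^ 0 * b 0 ^ 32 + ((2 : ℕ) : R) ^ 1 * b 1 ^ 16 +
      ((2 : ℕ) : R) ^ 2 * b 2 ^ 8 + ((2 : ℕ) : R) ^ 3 * b 3 ^ 4 + ((2 : ℕ) : R) ^ 4 * b 4 ^ 2 +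
      ((2 : ℕ) : R) ^ 5 * b 5 ^ 1 = _
    push_cast
    ring
  rw [key]
  have h2 := two_mul_pow_eight_mem hT
  exact add_mem (add_mem (add_mem (add_mem (add_mem (pow_sixteen_mem hT _) (h2 _))
    (add_mem (h2 _) (h2 _))) (eight_mul_pow_four_mem hT _)) (sixteen_mul_sq_mem hT _))
    (thirty_two_mul_mem hT _)

lemma Wstar_subset (hT : ∀ t d : R, tracePow t d ∈ T) : Wstar R ⊆ T :=
  Set.union_subset (Wbar_subset hT) (W_two_five_subset hT)

/-- If `2 ∣ x - a ^ 2` is solvable in `a` for every `x`, then so is `2 ∣ x - a ^ 2 ^ k`, since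
`2 ∣ a - b` implies `2 ∣ a ^ j - b ^ j`. -/
lemma EveryElementIsSquareModTwo.exists_eq_pow_add (h : EveryElementIsSquareModTwo R) (k : ℕ)
    (x : R) : ∃ a y : R, x = a ^ 2 ^ k + 2 * y := by
  induction k with
  | zero => exact ⟨x, 0, by simp⟩
  | succ k ih =>
    obtain ⟨a, y, rfl⟩ := ih
    obtain ⟨b, hb⟩ := h a
    obtain ⟨c, hc⟩ := (Ideal.mem_span_singleton.1 hb).trans (sub_dvd_pow_sub_pow a (b ^ 2) (2 ^ k))
    refine ⟨b, y + c, ?_⟩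
    rw [pow_succ', pow_mul]
    linear_combination hc

lemma EveryElementIsSquareModTwo.mem_W (h : EveryElementIsSquareModTwo R) (s : ℕ) (x : R) :
    x ∈ W 2 s R := by
  induction s generalizing x with
  | zero => exact ⟨fun _ ↦ x, by simp⟩
  | succ s ih =>
    obtain ⟨a, y, rfl⟩ := h.exists_eq_pow_add (s + 1) x
    obtain ⟨b, rfl⟩ := ih y
    refine ⟨Fin.cons a b, ?_⟩
    rw [Fin.sum_univ_succ (n := s + 1), Finset.mul_sum]
    simp [pow_succ' (2 : R), mul_assoc]

end TracePow

/-! ### Sums of powers of matrices and their traces -/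

section Powers

variable {R : Type*} [CommRing R] {n : ℕ}

open Matrix

lemma isSumOfPowers_iff_mem_closure (k : ℕ) (M : Matrix (Fin n) (Fin n) R) :
    IsSumOfPowers k M ↔
      M ∈ AddSubmonoid.closure (Set.range fun A : Matrix (Fin n) (Fin n) R ↦ A ^ k) := by
  refine ⟨?_, fun h ↦ ?_⟩
  · rintro ⟨r, A, rfl⟩
    exact sum_mem fun i _ ↦ AddSubmonoid.subset_closure ⟨A i, rfl⟩
  · induction h using AddSubmonoid.closure_induction with
    | mem _ h =>
      obtain ⟨A, rfl⟩ := h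
      exact ⟨1, fun _ ↦ A, by simp⟩
    | zero => exact ⟨0, fun _ ↦ 0, by simp⟩
    | add _ _ _ _ h h' =>
      obtain ⟨r, A, rfl⟩ := h
      obtain ⟨s, B, rfl⟩ := h'
      exact ⟨r + s, Fin.append A B, by simp [Fin.sum_univ_add]⟩

lemma EveryMatrixIsSumOfPowers.of_mul {k l : ℕ} (h : EveryMatrixIsSumOfPowers n (k * l) R) :
    EveryMatrixIsSumOfPowers n l R := fun M ↦ by
  obtain ⟨r, A, rfl⟩ := h M
  exact ⟨r, fun i ↦ A i ^ k, by simp [pow_mul]⟩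

/-- The additive monoid of all sums of `16`-th powers of `n × n` matrices. -/
def sumsOfPowers (n : ℕ) (R : Type*) [CommRing R] : AddSubmonoid (Matrix (Fin n) (Fin n) R) :=
  AddSubmonoid.closure (Set.range fun A ↦ A ^ 16)

lemma pow_mem_sumsOfPowers (A : Matrix (Fin n) (Fin n) R) : A ^ 16 ∈ sumsOfPowers n R :=
  AddSubmonoid.subset_closure ⟨A, rfl⟩

lemma vecMulVec_mem_sumsOfPowers {u v : Fin n → R} (h : v ⬝ᵥ u = 1) :
    vecMulVec u v ∈ sumsOfPowers n R := by
  have hi : IsIdempotentElem (vecMulVec u v) := by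
    rw [IsIdempotentElem, vecMulVec_mul_vecMulVec, h, one_smul]
  rw [← hi.pow_succ_eq 15]
  exact pow_mem_sumsOfPowers _

lemma vecMulVec_single_single (i j : Fin n) (a b : R) :
    vecMulVec (Pi.single i a) (Pi.single j b) = single i j (a * b) := by
  ext k l
  by_cases hk : i = k <;> by_cases hl : j = l <;>
    simp [vecMulVec, single, Pi.single_apply, hk, hl, Ne.symm]

lemma single_one_mem_sumsOfPowers (i : Fin n) : single i i (1 : R) ∈ sumsOfPowers n R := by
  rw [single_eq_single_vecMulVec_single]
  exact vecMulVec_mem_sumsOfPowers (by simp)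

/-- The matrix `w` with block `!![0, -1; 1, -1]` at `i`, `j` satisfies `w ^ 4 = w`, hence `w` and
`w ^ 2` are `16`-th powers; their sum is `-1` on the block. -/
lemma single_neg_one_mem_sumsOfPowers {i j : Fin n} (hij : i ≠ j) :
    single i i (-1 : R) ∈ sumsOfPowers n R := by
  set w : Matrix (Fin n) (Fin n) R := single j i 1 - single i j 1 - single j j 1 with hw
  have h2 : w ^ 2 = single i j 1 - single i i 1 - single j i 1 := by
    simp [sq, hw, mul_sub, sub_mul, hij, hij.symm]
    abel
  have h4 : w ^ 4 = w := by
    rw [show 4 = 2 * 2 from rfl, pow_mul, h2]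
    simp [sq, hw, mul_sub, sub_mul, hij, hij.symm]
    abel
  have h16 : w ^ 16 = w := by rw [show 16 = 4 * 4 from rfl, pow_mul, h4, h4]
  have key : single i i (-1 : R) = w ^ 16 + (w ^ 2) ^ 16 + single j j 1 := by
    rw [← pow_mul, mul_comm, pow_mul, h16, h2, hw, ← single_neg]
    abel
  rw [key]
  exact add_mem (add_mem (pow_mem_sumsOfPowers _) (pow_mem_sumsOfPowers _))
    (single_one_mem_sumsOfPowers j)

lemma single_mem_sumsOfPowers_of_ne {i j : Fin n} (hij : i ≠ j) (x : R) :
    single i j x ∈ sumsOfPowers n R := by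
  have key : single i j x = vecMulVec (Pi.single i 1) (Pi.single i 1 + Pi.single j x) +
      single i i (-1) := by
    simp only [vecMulVec_add, vecMulVec_single_single, ← single_neg, one_mul]
    abel
  rw [key]
  exact add_mem (vecMulVec_mem_sumsOfPowers (by simp [hij.symm]))
    (single_neg_one_mem_sumsOfPowers hij)

/-- The vectors `e_i + e_j` and `(1 - x) e_i + x e_j` have dot product `1`, and the idempotent
`vecMulVec` of the two has diagonal entries `1 - x` and `x`. -/
lemma single_sub_single_mem_sumsOfPowers {i j : Fin n} (hij : i ≠ j) (x : R) :
    single j j x - single i i x ∈ sumsOfPowers n R := by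
  have key : single j j x - single i i x =
      vecMulVec (Pi.single i 1 + Pi.single j 1) (Pi.single i (1 - x) + Pi.single j x) +
      single i i (-1) + single i j (-x) + single j i (-(1 - x)) := by
    have hs (k l : Fin n) : single k l (1 - x) = single k l 1 - single k l x :=
      map_sub (singleAddMonoidHom k l) 1 x
    simp only [vecMulVec_add, add_vecMulVec, vecMulVec_single_single, ← single_neg, one_mul, hs]
    abel
  rw [key]
  exact add_mem (add_mem (add_mem (vecMulVec_mem_sumsOfPowers (by simp [hij, hij.symm]))
    (single_neg_one_mem_sumsOfPowers hij)) (single_mem_sumsOfPowers_of_ne hij _))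
    (single_mem_sumsOfPowers_of_ne hij.symm _)

/-- `M` is a sum of matrices `single i j (M i j)` with `i ≠ j` and of differences
`single i i (M i i) - single i₀ i₀ (M i i)`. -/
lemma mem_sumsOfPowers_of_trace_eq_zero (hn : 2 ≤ n) {M : Matrix (Fin n) (Fin n) R}
    (hM : M.trace = 0) : M ∈ sumsOfPowers n R := by
  let i₀ : Fin n := ⟨0, by omega⟩
  let N (i j : Fin n) : Matrix (Fin n) (Fin n) R :=
    single i j (M i j) - if i = j then single i₀ i₀ (M i j) else 0
  have key : M = ∑ i, ∑ j, N i j := by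
    simp only [N, Finset.sum_sub_distrib, Finset.sum_ite_eq, Finset.mem_univ, if_true]
    rw [← matrix_eq_sum_single, eq_comm, sub_eq_self]
    change ∑ i, singleAddMonoidHom i₀ i₀ (M.diag i) = 0
    rw [← map_sum, ← trace, hM, map_zero]
  rw [key]
  refine sum_mem fun i _ ↦ sum_mem fun j _ ↦ ?_
  by_cases hij : i = j
  · subst hij
    by_cases hi : i = i₀
    · simp [N, hi]
    · simpa [N] using single_sub_single_mem_sumsOfPowers (Ne.symm hi) (M i i)
  · simpa [N, hij] using single_mem_sumsOfPowers_of_ne hij (M i j)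

/-- The additive monoid of the traces of sums of `16`-th powers of `n × n` matrices. -/
def tracesOfSums (n : ℕ) (R : Type*) [CommRing R] : AddSubmonoid R :=
  (sumsOfPowers n R).map (traceAddMonoidHom (Fin n) R)

lemma mem_sumsOfPowers_iff (hn : 2 ≤ n) {M : Matrix (Fin n) (Fin n) R} :
    M ∈ sumsOfPowers n R ↔ M.trace ∈ tracesOfSums n R := by
  refine ⟨fun h ↦ ⟨M, h, rfl⟩, ?_⟩
  rintro ⟨N, hN, h⟩
  rw [← add_sub_cancel N M]
  refine add_mem hN (mem_sumsOfPowers_of_trace_eq_zero hn ?_)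
  rw [trace_sub, ← h]
  exact sub_self _

lemma trace_sq_fin_two (A : Matrix (Fin 2) (Fin 2) R) :
    (A ^ 2).trace = A.trace ^ 2 - 2 * A.det := by
  simp only [sq, trace_fin_two, det_fin_two, mul_apply, Fin.sum_univ_two]
  ring

lemma trace_pow_sixteen_fin_two (A : Matrix (Fin 2) (Fin 2) R) :
    (A ^ 16).trace = tracePow A.trace A.det := by
  rw [show 16 = 2 * 2 * 2 * 2 from rfl]
  simp only [pow_mul _ _ 2, trace_sq_fin_two, det_pow, tracePow]
  ring

lemma trace_pow_mem_tracesOfSums (hn : 2 ≤ n) (A : Matrix (Fin 2) (Fin 2) R) :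
    (A ^ 16).trace ∈ tracesOfSums n R := by
  obtain ⟨m, rfl⟩ := Nat.exists_eq_add_of_le hn
  let e : Fin 2 ⊕ Fin m ≃ Fin (2 + m) := finSumFinEquiv
  refine ⟨(reindexAlgEquiv R R e (fromBlocks A 0 0 0)) ^ 16, pow_mem_sumsOfPowers _, ?_⟩
  rw [← map_pow, fromBlocks_diagonal_pow]
  simp [trace, ← Equiv.sum_comp e]

lemma tracePow_mem_tracesOfSums (hn : 2 ≤ n) (t d : R) : tracePow t d ∈ tracesOfSums n R := by
  have := trace_pow_mem_tracesOfSums hn !![t, -d; 1, 0]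
  rwa [trace_pow_sixteen_fin_two, trace_fin_two_of, det_fin_two_of, add_zero, mul_zero, mul_one,
    zero_sub, neg_neg] at this

lemma isSumOfPowers_of_trace_mem_Wstar (hn : 2 ≤ n) {M : Matrix (Fin n) (Fin n) R}
    (hM : M.trace ∈ Wstar R) : IsSumOfPowers 16 M := by
  have hT := tracePow_mem_tracesOfSums (R := R) hn
  refine (isSumOfPowers_iff_mem_closure 16 M).2 ((mem_sumsOfPowers_iff hn).2 ?_)
  exact Wstar_subset (T := { tracesOfSums n R with neg_mem' := neg_mem_of_tracePow_mem hT }) hT hM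

lemma EveryElementIsSquareModTwo.everyMatrixIsSumOfPowers (hn : 2 ≤ n)
    (h : EveryElementIsSquareModTwo R) : EveryMatrixIsSumOfPowers n 16 R :=
  fun _ ↦ isSumOfPowers_of_trace_mem_Wstar hn (Or.inr (h.mem_W 5 _))

/-- The difference is the sum of `A i i * A j j - A i j * A j i` over all `i`, `j`, in which the
terms at `(i, j)` and `(j, i)` agree and those at `(i, i)` vanish. -/
lemma trace_sq_of_charTwo {ι S : Type*} [Fintype ι] [CommRing S] [CharP S 2] (A : Matrix ι ι S) :
    (A * A).trace = A.trace ^ 2 := by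
  rw [← sub_eq_zero, ← neg_eq_zero, neg_sub, sq, trace, trace, Finset.sum_mul_sum]
  simp only [diag_apply, mul_apply, ← Finset.sum_sub_distrib]
  rw [← Finset.sum_product']
  refine Finset.sum_involution (fun p _ ↦ p.swap) (fun p _ ↦ ?_) (fun p _ hp h ↦ hp ?_)
    (fun _ _ ↦ Finset.mem_univ _) (fun p _ ↦ p.swap_swap)
  · convert CharTwo.add_self_eq_zero (A p.1 p.1 * A p.2 p.2 - A p.1 p.2 * A p.2 p.1) using 2
    simp only [Prod.fst_swap, Prod.snd_swap]
    ring
  · have h' : p.2 = p.1 := congrArg Prod.fst h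
    rw [h', sub_self]

lemma EveryMatrixIsSumOfPowers.everyElementIsSquareModTwo (hn : 2 ≤ n)
    (h : EveryMatrixIsSumOfPowers n 2 R) : EveryElementIsSquareModTwo R := fun x ↦ by
  let Q := R ⧸ Ideal.span {(2 : R)}
  let i₀ : Fin n := ⟨0, by omega⟩
  obtain ⟨r, A, hA⟩ := h (single i₀ i₀ x)
  refine ⟨∑ i, (A i).trace, ?_⟩
  have hx : x = ∑ i, (A i ^ 2).trace := by rw [← trace_sum, ← hA, trace_single_eq_same]
  rw [← Ideal.Quotient.eq, hx]
  obtain hQ | hQ := subsingleton_or_nontrivial Q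
  · exact Subsingleton.elim _ _
  have : CharP Q 2 := CharTwo.of_one_ne_zero_of_two_eq_zero one_ne_zero
    (Ideal.Quotient.eq_zero_iff_mem.2 (Ideal.mem_span_singleton_self (2 : R)))
  rw [map_sum, map_pow, map_sum, CharTwo.sum_sq]
  refine Finset.sum_congr rfl fun i _ ↦ ?_
  have := trace_sq_of_charTwo ((A i).map (Ideal.Quotient.mk (Ideal.span {(2 : R)})))
  rwa [← Matrix.map_mul, ← sq, ← AddMonoidHom.map_trace, ← AddMonoidHom.map_trace] at this

lemma everyMatrixIsSumOfPowers_tfae (hn : 2 ≤ n) : List.TFAE [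
    EveryMatrixIsSumOfPowers n 2 R, EveryMatrixIsSumOfPowers n 4 R,
    EveryMatrixIsSumOfPowers n 8 R, EveryMatrixIsSumOfPowers n 16 R,
    EveryElementIsSquareModTwo R] := by
  tfae_have 1 → 5 := fun h ↦ h.everyElementIsSquareModTwo hn
  tfae_have 5 → 4 := fun h ↦ h.everyMatrixIsSumOfPowers hn
  tfae_have 4 → 3 := fun h ↦ h.of_mul (k := 2)
  tfae_have 3 → 2 := fun h ↦ h.of_mul (k := 2)
  tfae_have 2 → 1 := fun h ↦ h.of_mul (k := 2)
  tfae_finish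

end Powers

/-! ### The discriminant modulo two -/

section Discriminant

/-- Multiplication by `Pi.single i x` factors through the `i`-th component, so cyclicity of the
trace applies. -/
lemma trace_pi_single {K ι : Type*} [Field K] [Fintype ι] [DecidableEq ι] (F : ι → Type*)
    [∀ i, CommRing (F i)] [∀ i, Algebra K (F i)] [∀ i, Module.Finite K (F i)] (i : ι) (x : F i) :
    Algebra.trace K (∀ i, F i) (Pi.single i x) = Algebra.trace K (F i) x := by
  have h1 : Algebra.lmul K (∀ i, F i) (Pi.single i x) =
      LinearMap.single K F i ∘ₗ (Algebra.lmul K (F i) x ∘ₗ LinearMap.proj i) := by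
    refine LinearMap.ext fun y ↦ funext fun j ↦ ?_
    obtain rfl | hj := eq_or_ne j i <;> simp [*]
  have h2 : (Algebra.lmul K (F i) x ∘ₗ LinearMap.proj i) ∘ₗ LinearMap.single K F i =
      Algebra.lmul K (F i) x := by
    ext y; simp
  rw [Algebra.trace_apply, h1, LinearMap.trace_comp_comm', h2, Algebra.trace_apply]

/-- Nilpotent elements lie in the kernel of the trace form. Conversely a reduced finite algebra over
a perfect field is a product of finite separable extensions, whose trace forms are
nondegenerate. -/
lemma traceForm_nondegenerate_iff_isReduced (K A : Type*) [Field K] [PerfectField K] [CommRing A]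
    [Algebra K A] [Module.Finite K A] : (Algebra.traceForm K A).Nondegenerate ↔ IsReduced A := by
  refine (LinearMap.IsRefl.nondegenerate_iff_separatingLeft
    (LinearMap.BilinForm.IsSymm.isRefl (Algebra.traceForm_isSymm K (S := A)))).trans ?_
  refine ⟨fun h ↦ ⟨fun x hx ↦ h x fun y ↦ ?_⟩, fun h x hx ↦ ?_⟩
  · exact (Algebra.isNilpotent_trace_of_isNilpotent
      ((Commute.all x y).isNilpotent_mul_right hx)).eq_zero
  · have : IsArtinianRing A := IsArtinianRing.of_finite K A
    classical
    have := Fintype.ofFinite (MaximalSpectrum A)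
    let e := (IsArtinianRing.equivPi A).restrictScalars K
    by_contra hne
    obtain ⟨I, hI⟩ := Function.ne_iff.1 ((map_ne_zero_iff e e.injective).2 hne)
    let _ : Field (A ⧸ I.asIdeal) := Ideal.Quotient.field _
    refine hI ((traceForm_nondegenerate K (A ⧸ I.asIdeal)).1 _ fun b ↦ ?_)
    have := hx (e.symm (Pi.single I b))
    rw [Algebra.traceForm_apply, ← Algebra.trace_eq_of_algEquiv e, map_mul, e.apply_symm_apply,
      ← Pi.single_mul_right, trace_pi_single (fun I : MaximalSpectrum A ↦ A ⧸ I.asIdeal)] at this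
    exact this

open TensorProduct

variable {B : Type*} [CommRing B]

lemma exists_one_tmul_eq (p : ℕ) (a : ZMod p ⊗[ℤ] B) : ∃ x : B, 1 ⊗ₜ x = a := by
  induction a with
  | zero => exact ⟨0, by simp⟩
  | add _ _ h h' =>
    obtain ⟨x, rfl⟩ := h
    obtain ⟨y, rfl⟩ := h'
    exact ⟨x + y, TensorProduct.tmul_add _ _ _⟩
  | tmul c x =>
    obtain ⟨c, rfl⟩ := ZMod.intCast_surjective c
    exact ⟨c • x, by rw [← TensorProduct.smul_tmul]; simp⟩

variable [Module.Free ℤ B] [Module.Finite ℤ B]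

lemma discr_baseChange {ι : Type*} [Fintype ι] [DecidableEq ι] (K : Type*) [CommRing K]
    (b : Module.Basis ι ℤ B) :
    Algebra.discr K (Algebra.TensorProduct.basis K b) = (Algebra.discr ℤ b : K) := by
  rw [Algebra.discr_def, Algebra.discr_def, ← eq_intCast (Int.castRingHom K), RingHom.map_det]
  congr 1
  ext i j
  simp only [Algebra.traceMatrix_apply, Algebra.traceForm_apply, RingHom.mapMatrix_apply,
    Matrix.map_apply, Algebra.TensorProduct.basis_apply, Algebra.TensorProduct.tmul_mul_tmul,
    mul_one]
  have h : Algebra.lmul K (K ⊗[ℤ] B) (1 ⊗ₜ (b i * b j)) =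
      (Algebra.lmul ℤ B (b i * b j)).baseChange K := by
    ext; simp
  rw [Algebra.trace_apply, Algebra.trace_apply, h, LinearMap.trace_baseChange]
  rfl

lemma dvd_iff_tmul_eq_zero (p : ℕ) (x : B) : (p : B) ∣ x ↔ (1 : ZMod p) ⊗ₜ[ℤ] x = 0 := by
  refine ⟨?_, fun h ↦ ?_⟩
  · rintro ⟨y, rfl⟩
    rw [← nsmul_eq_mul, ← TensorProduct.smul_tmul]
    simp
  · let b := Module.Free.chooseBasis ℤ B
    have hb (i) : (p : ℤ) ∣ b.repr x i := by
      rw [← ZMod.intCast_zmod_eq_zero_iff_dvd, ← one_mul ((b.repr x i : ℤ) : ZMod p)]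
      have := congr((Algebra.TensorProduct.basis (ZMod p) b).repr $h i)
      simpa [Algebra.TensorProduct.basis_repr_tmul] using this
    choose c hc using hb
    refine ⟨∑ i, c i • b i, ?_⟩
    conv_lhs => rw [← b.sum_repr x]
    simp [hc, Finset.mul_sum, mul_smul]

/-- The condition says that squaring is surjective on the finite ring `B / 2B`. It is additive
there, so this amounts to injectivity, that is to the absence of nonzero nilpotents. -/
lemma everyElementIsSquareModTwo_iff_isReduced :
    EveryElementIsSquareModTwo B ↔ IsReduced (ZMod 2 ⊗[ℤ] B) := by
  have : Fact (Nat.Prime 2) := ⟨Nat.prime_two⟩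
  have : Finite (ZMod 2 ⊗[ℤ] B) := Module.finite_of_finite (ZMod 2)
  have two : (2 : ZMod 2 ⊗[ℤ] B) = 0 := by
    have := (dvd_iff_tmul_eq_zero 2 (2 : B)).1 (by simp)
    rwa [← Algebra.TensorProduct.includeRight_apply, map_ofNat] at this
  have key : EveryElementIsSquareModTwo B ↔
      Function.Surjective fun a : ZMod 2 ⊗[ℤ] B ↦ a ^ 2 := by
    have h (x a : B) : x - a ^ 2 ∈ Ideal.span {2} ↔
        ((1 : ZMod 2) ⊗ₜ[ℤ] a) ^ 2 = (1 : ZMod 2) ⊗ₜ[ℤ] x := by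
      rw [Ideal.mem_span_singleton, show (2 : B) = (2 : ℕ) by simp, dvd_iff_tmul_eq_zero,
        TensorProduct.tmul_sub, sub_eq_zero, Algebra.TensorProduct.tmul_pow, one_pow, eq_comm]
    simp_rw [EveryElementIsSquareModTwo, h]
    refine ⟨fun hB y ↦ ?_, fun hA x ↦ ?_⟩
    · obtain ⟨x, rfl⟩ := exists_one_tmul_eq 2 y
      exact (hB x).imp' _ fun _ ↦ id
    · obtain ⟨y, hy⟩ := hA (1 ⊗ₜ x)
      obtain ⟨a, rfl⟩ := exists_one_tmul_eq 2 y
      exact ⟨a, hy⟩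
  rw [key, ← Finite.injective_iff_surjective]
  refine ⟨fun h ↦ (isReduced_iff_pow_one_lt 2 one_lt_two).2 fun x hx ↦ h ?_, fun _ a b hab ↦ ?_⟩
  · simpa using hx
  · have hab' : a ^ 2 = b ^ 2 := hab
    refine sub_eq_zero.1 (pow_eq_zero_iff two_ne_zero |>.1 ?_)
    linear_combination hab' + (b ^ 2 - a * b) * two

lemma everyElementIsSquareModTwo_iff_odd_discr {ι : Type*} [Fintype ι] [DecidableEq ι]
    (b : Module.Basis ι ℤ B) :
    EveryElementIsSquareModTwo B ↔ Int.gcd 2 (Algebra.discr ℤ b) = 1 := by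
  have : Fact (Nat.Prime 2) := ⟨Nat.prime_two⟩
  rw [everyElementIsSquareModTwo_iff_isReduced,
    ← traceForm_nondegenerate_iff_isReduced (ZMod 2),
    LinearMap.BilinForm.nondegenerate_iff_det_ne_zero (Algebra.TensorProduct.basis (ZMod 2) b),
    ← Algebra.traceMatrix_of_basis, ← Algebra.discr_def, discr_baseChange, Ne,
    ZMod.intCast_zmod_eq_zero_iff_dvd, ← Int.isCoprime_iff_gcd_eq_one]
  exact (Int.prime_two.coprime_iff_not_dvd).symm

end Discriminant

end MatrixWaring

theorem theorem1p4 (n : ℕ) (hn : 2 ≤ n) :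
    (∀ (R : Type u) [CommRing R],
      List.TFAE [
        MatrixWaring.EveryMatrixIsSumOfPowers n 2 R,
        MatrixWaring.EveryMatrixIsSumOfPowers n 4 R,
        MatrixWaring.EveryMatrixIsSumOfPowers n 8 R,
        MatrixWaring.EveryMatrixIsSumOfPowers n 16 R,
        MatrixWaring.EveryElementIsSquareModTwo R] ∧
      ∀ M : Matrix (Fin n) (Fin n) R,
        M.trace ∈ MatrixWaring.Wstar R → MatrixWaring.IsSumOfPowers 16 M) ∧
    (∀ (K : Type v) [Field K] [NumberField K] (O : Subring K) (hO : MatrixWaring.IsOrder O),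
      List.TFAE [
        MatrixWaring.EveryMatrixIsSumOfPowers n 2 O,
        MatrixWaring.EveryMatrixIsSumOfPowers n 4 O,
        MatrixWaring.EveryMatrixIsSumOfPowers n 8 O,
        MatrixWaring.EveryMatrixIsSumOfPowers n 16 O,
        MatrixWaring.EveryElementIsSquareModTwo O,
        Int.gcd 2 hO.disc = 1]) := by
  refine ⟨fun R _ ↦ ⟨MatrixWaring.everyMatrixIsSumOfPowers_tfae hn,
    fun M ↦ MatrixWaring.isSumOfPowers_of_trace_mem_Wstar hn⟩, fun K _ _ O hO ↦ ?_⟩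
  have := hO.finite
  have h := MatrixWaring.everyMatrixIsSumOfPowers_tfae (R := O) hn
  tfae_have 1 ↔ 2 := h.out 0 1
  tfae_have 1 ↔ 3 := h.out 0 2
  tfae_have 1 ↔ 4 := h.out 0 3
  tfae_have 1 ↔ 5 := h.out 0 4
  tfae_have 5 ↔ 6 := MatrixWaring.everyElementIsSquareModTwo_iff_odd_discr _
  tfae_finish
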